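/- Let $m\ge 3$ be an integer, let $D\subset\{0,1,\dots,m-1\}$ with $1<\#D<m$, and let $$K_{m,D}=\Bigl\{\sum_{j=1}^\infty \frac{a_j}{m^j} : a_j\in D\text{ for all } j\ge 1\Bigr\}\subset[0,1],\qquad c_{m,D}=2(m-1)\min\Bigl\{1,\frac{\#D}{m-\#D}\Bigr\}.$$ For coprime integers $u,q\ge 1$ let $\operatorname{ord}_q(u)$ be the multiplicative order of $u$ modulo $q$ (with $\operatorname{ord}_1(u)=1$), let $\operatorname{rad}(q)$ be the product of the distinct primes dividing $q$, and let $\nu_p$ be the $p$-adic valuation. Let $p_0\nmid m$ be a prime and set $$t=t(m,p_0)=\begin{cases}\nu_{p_0}\bigl(m^{\operatorname{ord}_{p_0}(m)}-1\bigr), & p_0\text{ odd},\\ \nu_2(m^2-1)-1, & p_0=2.\end{cases}$$ Let $Q\ge 2$ be an integer with $\gcd(Q,m)=1$, and let $r$ be an integer with $0<r<Q$ and $\gcd(mr,Q)=1$. If $\frac rQ\in K_{m,D}$, then $$\nu_{p_0}(Q)\le t+\nu_{p_0}\bigl(\operatorname{ord}_{\operatorname{rad}(Q)}(m)\bigr)+\log_{p_0}(c_{m,D}),$$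 and, equivalently, $$\nu_{p_0}(Q)\le t+\max_{p\mid Q}\nu_{p_0}\bigl(\operatorname{ord}_p(m)\bigr)+\log_{p_0}(c_{m,D}),$$ where the maximum is over the primes $p$ dividing $Q$. -/

import Mathlib

namespace MissingDigit

/-- The missing-digit set `K_{m,D}`: all sums `∑_{j ≥ 1} a_j / m^j` with every `a_j ∈ D`.
The index `j : ℕ` starts at `0`, so `a j` is the digit at position `j + 1`. -/
def missingDigitSet (m : ℕ) (D : Finset ℕ) : Set ℝ :=
  {x | ∃ a : ℕ → ℕ, (∀ j, a j ∈ D) ∧ HasSum (fun j => (a j : ℝ) / (m : ℝ) ^ (j + 1)) x}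

/-- The multiplicative order `ord_q(u)` of `u` modulo `q`; it is `1` for `q = 1`. -/
noncomputable def ordMod (q u : ℕ) : ℕ := orderOf (u : ZMod q)

/-- The constant `c_{m,D} = 2 (m - 1) min {1, #D / (m - #D)}`. -/
noncomputable def korobovConst (m : ℕ) (D : Finset ℕ) : ℝ :=
  2 * ((m : ℝ) - 1) * min 1 ((D.card : ℝ) / ((m : ℝ) - (D.card : ℝ)))

/-- The overhead parameter `t(m,p)` of a base `m ≥ 3` and a prime `p ∤ m`. No subtraction
truncates for such `m` and `p`. -/
noncomputable def overhead (m p : ℕ) : ℕ :=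
  if p = 2 then padicValNat 2 (m ^ 2 - 1) - 1
  else padicValNat p (m ^ ordMod p m - 1)

end MissingDigit

/-! Write p for p₀ and Q = p^v * Q' with p ∤ Q'. Multiplication by m shifts digits, so every r * m^i
/ Q mod 1 has its leading digit in D. Let L be an exponent with m^L ≡ 1 modulo each prime factor of
Q. Lifting the exponent gives a multiple E of L * Q' such that m^E ≡ 1 modulo Q' and m^(E * p^j) - 1
has p-adic valuation k + j, where k is at most t + ν_p(L), plus 1 if p = 2. If v > k, then m^E has
order N = p^(v-k) modulo Q, so its powers carry r through the whole residue class of r modulo Q / N: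
N points of [0,1) at spacing 1/N (`exists_mul_pow_mod_eq`). As D omits a digit, this forces N ≤ #D
(`le_card_of_leading_digits_mem`). Finally 2 * #D ≤ c_{m,D}, the 2 absorbing the loss at p = 2. -/

namespace MissingDigit

/-- A base-`m` expansion takes values in `[0, 1]`. -/
theorem hasSum_digits_mem_Icc {m : ℕ} (hm : 2 ≤ m) {a : ℕ → ℕ} (ha : ∀ j, a j < m) {x : ℝ}
    (hx : HasSum (fun j => (a j : ℝ) / (m : ℝ) ^ (j + 1)) x) : 0 ≤ x ∧ x ≤ 1 := by
  have hm' : (2 : ℝ) ≤ m := by exact_mod_cast hm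
  have hm0 : (0 : ℝ) < m := by linarith
  have hm1 : (m : ℝ) - 1 ≠ 0 := by linarith
  refine ⟨hx.nonneg fun j => by positivity, ?_⟩
  have hg : HasSum (fun j : ℕ => ((m : ℝ) - 1) / (m : ℝ) ^ (j + 1)) 1 := by
    have h := (hasSum_geometric_of_lt_one (r := (m : ℝ)⁻¹) (by positivity)
      (inv_lt_one_of_one_lt₀ (by linarith))).mul_left (((m : ℝ) - 1) / m)
    have hs : (1 : ℝ) = ((m : ℝ) - 1) / m * (1 - (m : ℝ)⁻¹)⁻¹ := by
      have : (1 : ℝ) - (m : ℝ)⁻¹ = ((m : ℝ) - 1) / m := by field_simp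
      rw [this, mul_inv_cancel₀ (div_ne_zero hm1 hm0.ne')]
    have hf : (fun j : ℕ => ((m : ℝ) - 1) / (m : ℝ) ^ (j + 1)) =
        fun j => ((m : ℝ) - 1) / m * (m : ℝ)⁻¹ ^ j := by
      funext j
      rw [inv_pow, pow_succ]
      field_simp
    rw [hf]
    rwa [← hs] at h
  refine hasSum_le (fun j => ?_) hx hg
  have : (a j : ℝ) + 1 ≤ m := by exact_mod_cast ha j
  gcongr
  linarith

/-- The tail of a base-`m` expansion of `x` is an expansion of `m * x - a 0`. -/
theorem hasSum_digits_tail {m : ℕ} (hm : 0 < m) {a : ℕ → ℕ} {x : ℝ}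
    (hx : HasSum (fun j => (a j : ℝ) / (m : ℝ) ^ (j + 1)) x) :
    HasSum (fun j => (a (j + 1) : ℝ) / (m : ℝ) ^ (j + 1)) (m * x - a 0) := by
  have hm0 : (m : ℝ) ≠ 0 := by positivity
  have h := ((hasSum_nat_add_iff' 1).2 hx).mul_left (m : ℝ)
  have hs : (m : ℝ) * x - a 0 =
      m * (x - ∑ i ∈ Finset.range 1, (a i : ℝ) / (m : ℝ) ^ (i + 1)) := by
    rw [Finset.sum_range_one, zero_add, pow_one]
    field_simp
  have hf : (fun j => (a (j + 1) : ℝ) / (m : ℝ) ^ (j + 1)) =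
      fun j => (m : ℝ) * ((a (j + 1) : ℝ) / (m : ℝ) ^ (j + 1 + 1)) := by
    funext j
    rw [pow_succ (m : ℝ) (j + 1)]
    field_simp
  rw [hs, hf]
  exact h

/-- If `r / Q` has an expansion with digits in `D`, then so has each fraction in its orbit
under multiplication by `m`; in particular their leading digits lie in `D`. -/
theorem leading_digit_orbit_mem {m : ℕ} (hm : 2 ≤ m) {D : Finset ℕ} (hD : D ⊆ Finset.range m)
    {Q : ℕ} (hQ : 2 ≤ Q) (hmQ : m.Coprime Q) (i : ℕ) :
    ∀ (r : ℕ), r.Coprime Q → (r : ℝ) / (Q : ℝ) ∈ missingDigitSet m D →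
      m * (r * m ^ i % Q) / Q ∈ D := by
  have hQ0 : (0 : ℝ) < Q := by positivity
  have key : ∀ r : ℕ, r.Coprime Q → (r : ℝ) / (Q : ℝ) ∈ missingDigitSet m D → r < Q := by
    rintro r hr ⟨a, ha, hx⟩
    have h := (hasSum_digits_mem_Icc hm (fun j => Finset.mem_range.1 (hD (ha j))) hx).2
    rw [div_le_one hQ0] at h
    have h' : r ≤ Q := by exact_mod_cast h
    -- The value 1 is attained by the expansion with all digits m - 1; coprimality with Q ≥ 2 rules
    -- it out, so the first digit is a genuine floor.
    refine lt_of_le_of_ne h' ?_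
    rintro rfl
    rw [Nat.coprime_self] at hr
    omega
  have step : ∀ r : ℕ, r.Coprime Q → (r : ℝ) / (Q : ℝ) ∈ missingDigitSet m D →
      ∃ d ∈ D, ∃ r' : ℕ, m * r = Q * d + r' ∧ r'.Coprime Q ∧
        (r' : ℝ) / (Q : ℝ) ∈ missingDigitSet m D := by
    rintro r hr ⟨a, ha, hx⟩
    have ht := hasSum_digits_tail (by omega) hx
    have h0 := (hasSum_digits_mem_Icc hm
      (fun j => Finset.mem_range.1 (hD (ha (j + 1)))) ht).1
    have hle : Q * a 0 ≤ m * r := by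
      have : (a 0 : ℝ) ≤ m * r / Q := by rw [mul_div_assoc]; linarith
      rw [le_div_iff₀ hQ0] at this
      rw [mul_comm]
      exact_mod_cast this
    obtain ⟨r', hr'⟩ := Nat.exists_eq_add_of_le hle
    refine ⟨a 0, ha 0, r', hr', ?_, fun j => a (j + 1), fun j => ha _, ?_⟩
    · have := hmQ.mul_left hr
      rw [hr'] at this
      simpa using this
    · convert ht using 1
      have : (m : ℝ) * r = Q * a 0 + r' := by exact_mod_cast hr'
      field_simp
      linarith
  induction i with
  | zero =>
    intro r hr hK
    obtain ⟨d, hd, r', h, hr', hK'⟩ := step r hr hK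
    have h2 := key r' hr' hK'
    rw [pow_zero, mul_one, Nat.mod_eq_of_lt (key r hr hK), h, Nat.mul_add_div (by omega),
      Nat.div_eq_of_lt h2]
    simpa using hd
  | succ i ih =>
    intro r hr hK
    obtain ⟨d, hd, r', h, hr', hK'⟩ := step r hr hK
    have : r * m ^ (i + 1) = r' * m ^ i + Q * (d * m ^ i) := by
      rw [pow_succ, show r * (m ^ i * m) = m * r * m ^ i by ring, h]
      ring
    rw [this, Nat.add_mul_mod_self_left]
    exact ih r' hr' hK'

/-- If the `N` multiples of `1 / N` shifted by `r / (N * q)` have leading digits in a proper subset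
`D` of the digits, then `N ≤ #D`. -/
theorem le_card_of_leading_digits_mem {m N q r : ℕ} (hm : 0 < m) (hq : 0 < q)
    {D : Finset ℕ} (hDm : D.card < m)
    (h : ∀ x < N * q, x ≡ r [MOD q] → m * x / (N * q) ∈ D) : N ≤ D.card := by
  rcases Nat.eq_zero_or_pos N with rfl | hN
  · simp
  have hr : r % q < q := Nat.mod_lt _ hq
  have hx : ∀ j < N, m * (r % q + q * j) / (N * q) ∈ D := by
    intro j hj
    refine h _ ?_ ?_
    · nlinarith
    · simp [Nat.ModEq]
  rcases le_or_gt N m with hNm | hNm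
  · rw [← Finset.card_range N]
    refine Finset.card_le_card_of_injOn (fun j => m * (r % q + q * j) / (N * q))
      (fun j hj => hx j (by simpa using hj)) ?_
    -- For N ≤ m the spacing 1/N is at least 1/m, so consecutive points have different leading
    -- digits.
    have hmono : StrictMono fun j => m * (r % q + q * j) / (N * q) := by
      refine strictMono_nat_of_lt_succ fun j => ?_
      have hNq : N * q ≤ m * q := Nat.mul_le_mul_right _ hNm
      calc m * (r % q + q * j) / (N * q)
          < m * (r % q + q * j) / (N * q) + 1 := Nat.lt_succ_self _
        _ = (m * (r % q + q * j) + N * q) / (N * q) :=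
            (Nat.add_div_right _ (by positivity)).symm
        _ ≤ _ := Nat.div_le_div_right (by nlinarith)
    exact hmono.injective.injOn
  · exfalso
    refine absurd (?_ : m ≤ D.card) (by omega)
    rw [← Finset.card_range m]
    refine Finset.card_le_card fun d hd => ?_
    rw [Finset.mem_range] at hd
    -- For N > m the spacing is below 1/m: the first point to reach d/m cannot jump past (d+1)/m, so
    -- every digit d occurs.
    have hex : ∃ j, d * N * q ≤ m * (r % q + q * j) := by
      refine ⟨d * N, ?_⟩
      nlinarith [Nat.zero_le (m * (r % q)), Nat.mul_le_mul_right (d * N * q) hm]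
    classical
    have hj := Nat.find_spec hex
    have hlt : m * (r % q + q * Nat.find hex) < (d + 1) * (N * q) := by
      rcases Nat.eq_zero_or_eq_succ_pred (Nat.find hex) with h0 | h0
      · rw [h0]
        have : m * (r % q) < N * q := by
          calc m * (r % q) ≤ N * (r % q) := Nat.mul_le_mul_right _ hNm.le
            _ < N * q := Nat.mul_lt_mul_of_pos_left hr hN
        nlinarith [Nat.zero_le (d * (N * q))]
      · have h1 := Nat.find_min hex (m := (Nat.find hex).pred) (by omega)
        rw [not_le] at h1
        rw [h0]
        have : m * q ≤ N * q := Nat.mul_le_mul_right _ hNm.le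
        simp only [Nat.succ_eq_add_one]
        nlinarith
    have hjN : Nat.find hex < N := by
      by_contra hcon
      rw [not_lt] at hcon
      have h1 : (d + 1) * (N * q) ≤ m * (N * q) := Nat.mul_le_mul_right _ hd
      have h2 : m * (N * q) ≤ m * (r % q + q * Nat.find hex) := by
        refine Nat.mul_le_mul_left _ ?_
        rw [mul_comm N q]
        exact (Nat.mul_le_mul_left q hcon).trans (Nat.le_add_left _ _)
      omega
    have := hx _ hjN
    rwa [Nat.div_eq_of_lt_le (k := d) (by rw [← mul_assoc]; exact hj) hlt] at this

/-- If `g ≡ 1` modulo `q` and `g` has order `N` modulo `N * q`, then the residues `r * g ^ i`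
exhaust the residue class of a unit `r` modulo `q`. -/
theorem exists_mul_pow_mod_eq {g N q r x : ℕ} (hN : 0 < N) (hq : 0 < q)
    (hg : g ≡ 1 [MOD q]) (hord : orderOf (g : ZMod (N * q)) = N) (hr : r.Coprime (N * q))
    (hx : x < N * q) (hxr : x ≡ r [MOD q]) : ∃ i, r * g ^ i % (N * q) = x := by
  let S := (Finset.range (N * q)).filter fun y => y ≡ r [MOD q]
  have hS : S.card ≤ N := by
    rw [← Finset.card_range N]
    refine Finset.card_le_card_of_injOn (fun y => y / q) ?_ ?_
    · intro y hy
      simp only [S, Finset.coe_filter, Finset.mem_range, Set.mem_ofPred_eq] at hy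
      simpa using Nat.div_lt_of_lt_mul (by rw [mul_comm]; exact hy.1)
    · intro y hy z hz hyz
      simp only [S, Finset.coe_filter, Finset.mem_range, Set.mem_ofPred_eq] at hy hz
      have h1 : y % q = z % q := hy.2.trans hz.2.symm
      have h2 : y / q = z / q := hyz
      rw [← Nat.div_add_mod y q, ← Nat.div_add_mod z q, h1, h2]
  have hmaps : Set.MapsTo (fun i => r * g ^ i % (N * q)) (Finset.range N : Finset ℕ) S := by
    intro i _
    simp only [S, Finset.coe_filter, Finset.mem_range, Set.mem_ofPred_eq]
    refine ⟨Nat.mod_lt _ (by positivity), ?_⟩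
    have h1 : r * g ^ i % (N * q) ≡ r * g ^ i [MOD q] :=
      (Nat.mod_modEq _ _).of_dvd (dvd_mul_left q N)
    have h2 : r * g ^ i ≡ r * 1 ^ i [MOD q] := (hg.pow i).mul_left r
    simpa using h1.trans h2
  have hinj : Set.InjOn (fun i => r * g ^ i % (N * q)) (Finset.range N : Finset ℕ) := by
    intro i hi j hj hij
    simp only [Finset.coe_range, Set.mem_Iio] at hi hj
    have h1 : g ^ i ≡ g ^ j [MOD N * q] :=
      Nat.ModEq.cancel_left_of_coprime (c := r) (by rw [Nat.gcd_comm]; exact hr) hij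
    have h2 : (g : ZMod (N * q)) ^ i = (g : ZMod (N * q)) ^ j := by
      exact_mod_cast (ZMod.natCast_eq_natCast_iff _ _ _).2 h1
    exact pow_injOn_Iio_orderOf (by simpa [hord] using hi) (by simpa [hord] using hj) h2
  have hsurj := Finset.surjOn_of_injOn_of_card_le _ hmaps hinj (by simpa using hS)
  obtain ⟨i, _, hi⟩ := hsurj (show x ∈ (S : Set ℕ) by simpa [S] using ⟨hx, hxr⟩)
  exact ⟨i, hi⟩

/-- If `x ≡ 1` modulo each prime factor of `n`, then `x ^ n ≡ 1` modulo `n`. -/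
theorem pow_self_modEq_one {n x : ℕ} (hn : n ≠ 0)
    (h : ∀ p, p.Prime → p ∣ n → x ≡ 1 [MOD p]) : x ^ n ≡ 1 [MOD n] := by
  rw [Nat.ModEq.comm, Nat.modEq_iff_dvd]
  have key : (n : ℤ) ∣ (x : ℤ) ^ n - 1 := by
    rw [← Int.natAbs_dvd_natAbs, Int.natAbs_natCast, Nat.dvd_iff_prime_pow_dvd_dvd]
    intro p k hp hpk
    rw [← Int.natCast_dvd]
    rcases Nat.eq_zero_or_pos k with rfl | hk
    · simp
    have hpx : (p : ℤ) ∣ (x : ℤ) - 1 := by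
      have := (Nat.modEq_iff_dvd.1 (h p hp ((dvd_pow_self p hk.ne').trans hpk)).symm)
      simpa using this
    have h1 := dvd_sub_pow_of_dvd_sub hpx k
    rw [one_pow] at h1
    obtain ⟨c, rfl⟩ := hpk
    rw [pow_mul]
    push_cast
    exact ((pow_dvd_pow (p : ℤ) k.le_succ).trans h1).trans
      (by simpa using sub_dvd_pow_sub_pow ((x : ℤ) ^ p ^ k) 1 c)
  simpa using key

/-- Lifting the exponent: after multiplying `L` by at most `2`, the `p`-adic valuation of
`m ^ (L * p ^ j) - 1` grows exactly linearly in `j`, starting from the overhead. -/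
theorem exists_valuation_pow_sub_one {m p L : ℕ} (hm : 2 ≤ m) (hp : p.Prime) (hpm : ¬ p ∣ m)
    (hL : 0 < L) (hpL : m ^ L ≡ 1 [MOD p]) :
    ∃ E k δ : ℕ, 0 < E ∧ L ∣ E ∧ p ^ δ ≤ 2 ∧ k ≤ overhead m p + padicValNat p L + δ ∧
      ∀ j, padicValNat p (m ^ (E * p ^ j) - 1) = k + j := by
  have := Fact.mk hp
  by_cases hp2 : p = 2
  · subst hp2
    have hodd : ¬ 2 ∣ m := hpm
    have hval : ∀ n, n ≠ 0 → Even n → padicValNat 2 (m ^ n - 1) + 1 =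
        padicValNat 2 (m + 1) + padicValNat 2 (m - 1) + padicValNat 2 n := by
      intro n hn hev
      have := padicValNat.pow_two_sub_pow (x := m) (y := 1) (by omega) (by omega) hodd hn hev
      simpa using this
    have h2 := hval 2 two_ne_zero even_two
    have h21 : padicValNat 2 2 = 1 := padicValNat.self (by norm_num)
    have hE : ∀ j, padicValNat 2 (2 * L * 2 ^ j) = 1 + padicValNat 2 L + j := by
      intro j
      rw [padicValNat.mul (by positivity) (by positivity),
        padicValNat.mul (by positivity) (by positivity), h21, padicValNat.prime_pow]
    have hpos : 1 ≤ padicValNat 2 (m + 1) :=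
      one_le_padicValNat_of_dvd (by omega) (by omega)
    have hpos' : 1 ≤ padicValNat 2 (m - 1) :=
      one_le_padicValNat_of_dvd (by omega) (by omega)
    -- Lifting at 2 needs an even exponent, hence 2 * L. Since `overhead` subtracts 1 from ν_2(m^2 -
    -- 1), this costs δ = 1.
    refine ⟨2 * L, padicValNat 2 (m ^ 2 - 1) + padicValNat 2 L, 1, by positivity,
      dvd_mul_left _ _, by norm_num, ?_, ?_⟩
    · simp only [overhead, if_true]
      omega
    · intro j
      have h := hval (2 * L * 2 ^ j) (by positivity) (by rw [mul_assoc]; exact even_two_mul _)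
      rw [hE] at h
      omega
  · have hdvd : ordMod p m ∣ L := by
      rw [ordMod, orderOf_dvd_iff_pow_eq_one]
      exact_mod_cast (ZMod.natCast_eq_natCast_iff _ _ _).2 hpL
    obtain ⟨f, hf⟩ := hdvd
    have ho : ordMod p m ≠ 0 := by rintro h; simp [h] at hf; omega
    have hf0 : f ≠ 0 := by rintro rfl; simp at hf; omega
    have hpo : p ∣ m ^ ordMod p m - 1 := by
      rw [← Nat.modEq_iff_dvd' (Nat.one_le_pow _ _ (by omega)), Nat.ModEq.comm,
        ← ZMod.natCast_eq_natCast_iff]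
      push_cast
      exact pow_orderOf_eq_one _
    refine ⟨L, overhead m p + padicValNat p f, 0, hL, dvd_rfl, by norm_num, ?_, ?_⟩
    · rw [hf, padicValNat.mul ho hf0]
      omega
    · intro j
      have h := padicValNat.pow_sub_pow (p := p) (x := m ^ ordMod p m) (y := 1)
        (hp.odd_of_ne_two hp2) (Nat.one_lt_pow ho (by omega)) hpo
        (fun h => hpm (hp.dvd_of_dvd_pow h)) (n := f * p ^ j) (by
          have := hp.pos
          positivity)
      rw [one_pow, ← pow_mul, ← mul_assoc, ← hf, padicValNat.mul hf0 (pow_ne_zero _ hp.ne_zero),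
        padicValNat.prime_pow] at h
      rw [h, overhead, if_neg hp2]
      omega

/-- In the two branches of the minimum, m - 1 ≥ #D and (m - 1) / (m - #D) ≥ 1 respectively. -/
theorem two_mul_card_le_korobovConst {m : ℕ} {D : Finset ℕ} (hD1 : 1 ≤ D.card)
    (hDm : D.card < m) : 2 * (D.card : ℝ) ≤ korobovConst m D := by
  have h1 : (1 : ℝ) ≤ D.card := by exact_mod_cast hD1
  have h2 : (D.card : ℝ) + 1 ≤ m := by exact_mod_cast hDm
  have h3 : (0 : ℝ) < (m : ℝ) - D.card := by linarith
  rw [korobovConst, mul_assoc]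
  refine mul_le_mul_of_nonneg_left ?_ zero_le_two
  rw [mul_min_of_nonneg _ _ (by linarith)]
  refine le_min (by linarith) ?_
  rw [mul_div_assoc', le_div_iff₀ h3]
  nlinarith

theorem padicValNat_lcm_le_sup (p : ℕ) [Fact p.Prime] {ι : Type*} (s : Finset ι) (f : ι → ℕ)
    (hf : ∀ i ∈ s, f i ≠ 0) : padicValNat p (s.lcm f) ≤ s.sup fun i => padicValNat p (f i) := by
  classical
  induction s using Finset.induction_on with
  | empty => simp
  | insert a s _ ih =>
    have ha : f a ≠ 0 := hf a (Finset.mem_insert_self a s)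
    have hs : ∀ i ∈ s, f i ≠ 0 := fun i hi => hf i (Finset.mem_insert_of_mem hi)
    have hl : s.lcm f ≠ 0 := by
      rw [Ne, Finset.lcm_eq_zero_iff]
      rintro ⟨i, hi, h0⟩
      exact hs i hi h0
    rw [Finset.lcm_insert, Finset.sup_insert]
    refine le_trans ?_ (sup_le_sup_left (ih hs) _)
    have hfac := congrArg (fun g => g p) (Nat.factorization_lcm ha hl)
    have hp : p.Prime := Fact.out
    simp only [Finsupp.sup_apply, Nat.factorization_def _ hp] at hfac
    exact hfac.le

/-- The valuation bound for any common exponent `L` of `m` modulo the prime factors of `Q`. -/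
theorem padicValNat_le_of_mem_missingDigitSet {m : ℕ} (hm : 2 ≤ m) {D : Finset ℕ}
    (hD : D ⊆ Finset.range m) (hD1 : 1 ≤ D.card) (hDm : D.card < m) {p : ℕ} (hp : p.Prime)
    (hpm : ¬ p ∣ m) {Q : ℕ} (hQ : 2 ≤ Q) (hmQ : m.Coprime Q) {r : ℕ} (hr : r.Coprime Q)
    (hK : (r : ℝ) / (Q : ℝ) ∈ missingDigitSet m D) {L : ℕ} (hL : 0 < L)
    (hLQ : ∀ l, l.Prime → l ∣ Q → m ^ L ≡ 1 [MOD l]) :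
    (padicValNat p Q : ℝ) ≤ (overhead m p : ℝ) + (padicValNat p L : ℝ)
      + Real.logb (p : ℝ) (korobovConst m D) := by
  have := Fact.mk hp
  have hp1 : (1 : ℝ) < p := by exact_mod_cast hp.one_lt
  have hc := two_mul_card_le_korobovConst hD1 hDm
  have hD1' : (1 : ℝ) ≤ D.card := by exact_mod_cast hD1
  suffices h : ∃ s : ℕ, padicValNat p Q ≤ overhead m p + padicValNat p L + s ∧
      p ^ s ≤ 2 * D.card by
    obtain ⟨s, h, hs⟩ := h
    have hs' : (s : ℝ) ≤ Real.logb p (korobovConst m D) := by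
      rw [Real.le_logb_iff_rpow_le hp1 (by linarith), Real.rpow_natCast]
      exact le_trans (by exact_mod_cast hs) hc
    have h' : (padicValNat p Q : ℝ) ≤ overhead m p + padicValNat p L + s := by exact_mod_cast h
    linarith
  by_cases hpQ : p ∣ Q
  swap
  · exact ⟨0, by simp [padicValNat.eq_zero_of_not_dvd hpQ], by simpa using by omega⟩
  obtain ⟨v, Q', hpQ', hQv⟩ := Nat.exists_eq_pow_mul_and_not_dvd (n := Q) (by omega) p hp.ne_one
  have hQ'0 : Q' ≠ 0 := by rintro rfl; simp at hpQ'
  have hv : padicValNat p Q = v := by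
    rw [hQv, padicValNat.mul (pow_ne_zero _ hp.ne_zero) hQ'0, padicValNat.prime_pow,
      padicValNat.eq_zero_of_not_dvd hpQ', add_zero]
  -- The factor Q' upgrades the congruence from the primes of Q' to Q' itself, and being prime to p
  -- it adds no valuation.
  have hLQ' : m ^ (L * Q') ≡ 1 [MOD Q'] := by
    rw [pow_mul]
    exact pow_self_modEq_one hQ'0 fun l hl hlQ => hLQ l hl (hlQ.trans ⟨p ^ v, by rw [hQv]; ring⟩)
  have hLp : m ^ (L * Q') ≡ 1 [MOD p] := by
    rw [pow_mul]
    simpa using (hLQ p hp hpQ).pow Q'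
  obtain ⟨E, k, δ, hE, ⟨f, hf⟩, hδ, hk, hval⟩ :=
    exists_valuation_pow_sub_one hm hp hpm (L := L * Q') (by positivity) hLp
  rw [padicValNat.mul hL.ne' hQ'0, padicValNat.eq_zero_of_not_dvd hpQ', add_zero] at hk
  rw [hv]
  rcases le_or_gt v k with hvk | hvk
  · exact ⟨δ, by omega, by omega⟩
  obtain ⟨n, hn⟩ := Nat.exists_eq_add_of_lt hvk
  suffices hcard : p ^ (n + 1) ≤ D.card by
    refine ⟨δ + (n + 1), by omega, ?_⟩
    rw [pow_add]
    exact Nat.mul_le_mul hδ hcard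
  have hpow1 : ∀ j, 1 ≤ m ^ j := fun j => Nat.one_le_pow _ _ (by omega)
  have hne : ∀ j, m ^ (E * p ^ j) - 1 ≠ 0 := fun j => by
    have := Nat.one_lt_pow (n := E * p ^ j)
      (Nat.mul_ne_zero hE.ne' (pow_ne_zero _ hp.ne_zero)) (show 1 < m by omega)
    omega
  have hEQ' : ∀ j, m ^ (E * p ^ j) ≡ 1 [MOD Q'] := fun j => by
    rw [hf, mul_assoc, pow_mul]
    simpa using hLQ'.pow (f * p ^ j)
  have hmod : ∀ j l, m ^ (E * p ^ j) ≡ 1 [MOD p ^ l * Q'] ↔ l ≤ k + j := by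
    intro j l
    have hcop : (p ^ l).Coprime Q' := ((Nat.Prime.coprime_iff_not_dvd hp).2 hpQ').pow_left l
    rw [← Nat.modEq_and_modEq_iff_modEq_mul hcop, and_iff_left (hEQ' j), Nat.ModEq.comm,
      Nat.modEq_iff_dvd' (hpow1 _), padicValNat_dvd_iff_le (hne j), hval]
  have hQN : Q = p ^ (n + 1) * (p ^ k * Q') := by
    rw [hQv, hn]
    ring
  have hq : 0 < p ^ k * Q' := Nat.mul_pos (pow_pos hp.pos k) (Nat.pos_of_ne_zero hQ'0)
  have hzmod : ∀ j, ((m ^ E : ℕ) : ZMod Q) ^ p ^ j = 1 ↔ v ≤ k + j := by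
    intro j
    rw [← hmod j v, ← hQv, ← ZMod.natCast_eq_natCast_iff, pow_mul]
    push_cast
    rfl
  -- Here v = k + n + 1, so the p^n-th power falls one factor p short of being 1 modulo Q.
  have hord : orderOf ((m ^ E : ℕ) : ZMod Q) = p ^ (n + 1) :=
    orderOf_eq_prime_pow (by rw [hzmod]; omega) (by rw [hzmod]; omega)
  refine le_card_of_leading_digits_mem (m := m) (r := r) (by omega) hq hDm fun x hx hxr => ?_
  obtain ⟨i, hi⟩ := exists_mul_pow_mod_eq (g := m ^ E) (pow_pos hp.pos _) hq
    (by simpa using (hmod 0 k).2 le_rfl) (by rw [← hQN]; exact hord) (hQN ▸ hr) hx hxr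
  rw [← hi, ← hQN, ← pow_mul]
  exact leading_digit_orbit_mem hm hD hQ hmQ (E * i) r hr hK

end MissingDigit

theorem mainTheorem2 (m : ℕ) (hm : 3 ≤ m) (D : Finset ℕ) (hD : D ⊆ Finset.range m)
    (hD1 : 1 < D.card) (hDm : D.card < m)
    (p₀ : ℕ) (hp₀ : p₀.Prime) (hp₀m : ¬ p₀ ∣ m)
    (Q : ℕ) (hQ : 2 ≤ Q) (hQm : Nat.gcd Q m = 1)
    (r : ℕ) (hr0 : 0 < r) (hrQ : r < Q) (hmr : Nat.gcd (m * r) Q = 1)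
    (hK : (r : ℝ) / (Q : ℝ) ∈ MissingDigit.missingDigitSet m D) :
    (padicValNat p₀ Q : ℝ) ≤ (MissingDigit.overhead m p₀ : ℝ)
        + (padicValNat p₀ (MissingDigit.ordMod (UniqueFactorizationMonoid.radical Q) m) : ℝ)
        + Real.logb (p₀ : ℝ) (MissingDigit.korobovConst m D) ∧
    (padicValNat p₀ Q : ℝ) ≤ (MissingDigit.overhead m p₀ : ℝ)
        + ((Q.primeFactors.sup fun p => padicValNat p₀ (MissingDigit.ordMod p m) : ℕ) : ℝ)
        + Real.logb (p₀ : ℝ) (MissingDigit.korobovConst m D) := by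
  have hmQ : m.Coprime Q := Nat.Coprime.symm hQm
  have hrQ' : r.Coprime Q := Nat.Coprime.coprime_mul_left hmr
  have hpow : ∀ n : ℕ, m ^ MissingDigit.ordMod n m ≡ 1 [MOD n] := fun n => by
    rw [← ZMod.natCast_eq_natCast_iff]
    push_cast
    exact pow_orderOf_eq_one _
  have hpos : ∀ n : ℕ, n ≠ 0 → m.Coprime n → 0 < MissingDigit.ordMod n m := fun n hn hmn => by
    have : NeZero n := ⟨hn⟩
    rw [MissingDigit.ordMod, ← ZMod.coe_unitOfCoprime m hmn, orderOf_units]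
    exact orderOf_pos _
  have hrad : UniqueFactorizationMonoid.radical Q ∣ Q := UniqueFactorizationMonoid.radical_dvd_self
  have := Fact.mk hp₀
  refine ⟨?_, ?_⟩
  · refine MissingDigit.padicValNat_le_of_mem_missingDigitSet (by omega) hD hD1.le hDm hp₀ hp₀m hQ
      hmQ hrQ' hK (hpos _ (UniqueFactorizationMonoid.radical_ne_zero) (hmQ.of_dvd_right hrad))
      fun l hl hlQ => (hpow _).of_dvd ?_
    exact (UniqueFactorizationMonoid.dvd_radical_iff_of_irreducible hl (by omega)).2 hlQ
  -- Here L is the lcm of the orders modulo the primes of Q, whose valuation is at most the largest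
  -- of theirs; the first bound took L to be the order modulo the radical.
  · have hL0 : 0 < Q.primeFactors.lcm fun p => MissingDigit.ordMod p m := by
      rw [Nat.pos_iff_ne_zero, Ne, Finset.lcm_eq_zero_iff]
      rintro ⟨p, hp, h0⟩
      have hp' := Nat.mem_primeFactors.1 hp
      exact (hpos p hp'.1.ne_zero (hmQ.of_dvd_right hp'.2.1)).ne' h0
    have h := MissingDigit.padicValNat_le_of_mem_missingDigitSet (by omega) hD hD1.le hDm hp₀ hp₀m
      hQ hmQ hrQ' hK hL0 fun l hl hlQ => by
        obtain ⟨c, hc⟩ := Finset.dvd_lcm (f := fun p => MissingDigit.ordMod p m)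
          (Nat.mem_primeFactors.2 ⟨hl, hlQ, by omega⟩)
        rw [hc, pow_mul]
        simpa using (hpow l).pow c
    have hsup := MissingDigit.padicValNat_lcm_le_sup p₀ Q.primeFactors (fun p => MissingDigit.ordMod p m)
      fun p hp => (hpos p (Nat.prime_of_mem_primeFactors hp).ne_zero
        (hmQ.of_dvd_right (Nat.dvd_of_mem_primeFactors hp))).ne'
    have hsup' : (padicValNat p₀ (Q.primeFactors.lcm fun p => MissingDigit.ordMod p m) : ℝ) ≤
        ((Q.primeFactors.sup fun p => padicValNat p₀ (MissingDigit.ordMod p m) : ℕ) : ℝ) := by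
      exact_mod_cast hsup
    linarith
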